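/- For an abelian category $\mathcal{C}$, an object $H$ is monoform if $H\neq 0$ and, for every non-zero subobject $N\subseteq H$, the objects $H$ and $H/N$ have no common non-zero subobject. Two monoform objects are atom equivalent if they have a common non-zero subobject. $\operatorname{ASpec}\mathcal{C}$ is the collection of equivalence classes $\langle H\rangle$ (atoms) of monoform objects $H$. The atom support $\operatorname{ASupp}K$ consists of the atoms $\langle H\rangle$ of monoform objects $H\cong L/L'$ with $L'\subseteq L\subseteq K$. A subset $\Phi\subseteq\operatorname{ASpec}\mathcal{C}$ is open if every atom in $\Phi$ equals $\langle H\rangle$ for some monoform $H$ with $\operatorname{ASupp}H\subseteq\Phi$; and $\alpha\leqslant\beta$ means that $\alpha$ lies in the closure of $\{\beta\}$. For a commutative ring $\Bbbk$, the set $\operatorname{Spec}\Bbbk$ of prime ideals is ordered by inclusion, and its open subsets are by definition the specialization-closed ones, i.e. the subsets $\Phi$ such that $\mathfrak{p}\in\Phi$ and $\mathfrak{p}\subseteq\mathfrak{q}$ imply $\mathfrak{q}\in\Phi$ (this is not the Zariski topology). Disjoint unions carry the disjoint union topology and order. Modules are left modules. Let $A$ and $B$ be rings, let $M={}_BM_A$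 be a $(B,A)$-bimodule, and let $$T=\begin{pmatrix}A&0\\ M&B\end{pmatrix}.$$ (1) There is a homeomorphism and order-isomorphism $\operatorname{ASpec}(\operatorname{Mod}A)\sqcup\operatorname{ASpec}(\operatorname{Mod}B)\to\operatorname{ASpec}(\operatorname{Mod}T)$ which sends $\langle H\rangle$ to $\langle H\rangle$, where a monoform $A$-module (respectively $B$-module) $H$ is viewed as a $T$-module, which is again monoform, via the ring homomorphism $T\to A$ (respectively $T\to B$) that takes a matrix to its upper left (respectively lower right) entry. (2) If $A$ and $B$ are commutative, there is a homeomorphism and order-isomorphism $\operatorname{Spec}A\sqcup\operatorname{Spec}B\to\operatorname{ASpec}(\operatorname{Mod}T)$ given by $$\mathfrak{p}\longmapsto\left\langle T\Big/\begin{pmatrix}\mathfrak{p}&0\\ M&B\end{pmatrix}\right\rangle\quad(\mathfrak{p}\in\operatorname{Spec}A),\qquad \mathfrak{q}\longmapsto\left\langle T\Big/\begin{pmatrix}A&0\\ M&\mathfrak{q}\end{pmatrix}\right\rangle\quad(\mathfrak{q}\in\operatorname{Spec}B);$$ in particular the quotients of $T$ by these left ideals are monoform. -/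

import Mathlib

open CategoryTheory CategoryTheory.Limits

universe u v w

/-! ### Atoms in an abelian category -/

namespace AtomTheory

section

variable {C : Type u} [Category.{v} C] [Abelian C]

/-- `H` is monoform: it is non-zero, and for every non-zero subobject `N` of `H`, the objects `H`
and `H / N` have no common non-zero subobject. -/
def Monoform (H : C) : Prop :=
  ¬ IsZero H ∧
    ∀ ⦃N : C⦄ (i : N ⟶ H) [Mono i], ¬ IsZero N →
      ∀ ⦃X : C⦄ (f : X ⟶ H) (g : X ⟶ cokernel i) [Mono f] [Mono g], IsZero X

/-- `H` and `H'` have a common non-zero subobject. -/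
def AtomEquiv (H H' : C) : Prop :=
  ∃ X : C, ¬ IsZero X ∧ ∃ (f : X ⟶ H) (g : X ⟶ H'), Mono f ∧ Mono g

/-- Two non-zero subobjects of a monoform object have non-zero intersection. -/
theorem Monoform.not_isZero_pullback {H : C} (hH : Monoform H) {X Y : C} (x : X ⟶ H) (y : Y ⟶ H)
    [Mono x] [Mono y] (hX : ¬ IsZero X) (hY : ¬ IsZero Y) : ¬ IsZero (pullback x y) := by
  intro h0
  have : Mono (y ≫ cokernel.π x) := by
    apply Preadditive.mono_of_cancel_zero
    intro Z g hg
    have hk : (g ≫ y) ≫ cokernel.π x = 0 := by simpa using hg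
    have e : Abelian.monoLift x (g ≫ y) hk ≫ x = g ≫ y := Abelian.monoLift_comp x (g ≫ y) hk
    have := h0.eq_of_tgt (pullback.lift _ _ e) 0
    rw [← pullback.lift_snd _ _ e, this, zero_comp]
  exact hY (hH.2 x hX y (y ≫ cokernel.π x))

/-- A non-zero subobject of a monoform object is monoform. -/
theorem Monoform.of_mono {H X : C} (hH : Monoform H) (x : X ⟶ H) [Mono x] (hX : ¬ IsZero X) :
    Monoform X := by
  refine ⟨hX, ?_⟩
  intro N i _ hN Y f g _ _
  have sq : IsPullback i (𝟙 N) x (i ≫ x) :=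
    ⟨⟨by simp⟩, ⟨PullbackCone.IsLimit.mk _ (fun s => s.snd)
      (fun s => by rw [← cancel_mono x]; simpa using s.condition.symm)
      (fun s => by simp) (fun s m _ h => by simpa using h)⟩⟩
  have hm := Abelian.mono_cokernel_map_of_isPullback sq
  exact hH.2 (i ≫ x) hN (f ≫ x) (g ≫ cokernel.map _ _ _ _ sq.w)

theorem AtomEquiv.trans {H H' H'' : C} (hH' : Monoform H') (h : AtomEquiv H H')
    (h' : AtomEquiv H' H'') : AtomEquiv H H'' := by
  obtain ⟨X, hX, f, g, _, _⟩ := h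
  obtain ⟨Y, hY, f', g', _, _⟩ := h'
  exact ⟨pullback g f', hH'.not_isZero_pullback g f' hX hY, pullback.fst g f' ≫ f,
    pullback.snd g f' ≫ g', inferInstance, inferInstance⟩

variable (C)

/-- Atom equivalence on the monoform objects. -/
def atomSetoid : Setoid {H : C // Monoform H} where
  r H H' := AtomEquiv H.1 H'.1
  iseqv :=
    { refl := fun H => ⟨H.1, H.2.1, 𝟙 _, 𝟙 _, inferInstance, inferInstance⟩
      symm := fun ⟨X, hX, f, g, hf, hg⟩ => ⟨X, hX, g, f, hg, hf⟩
      trans := fun {_ y _} h h' => AtomEquiv.trans y.2 h h' }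

/-- The atom spectrum: the collection of equivalence classes of monoform objects. -/
def ASpec : Type u := Quotient (atomSetoid C)

variable {C}

/-- The atom represented by a monoform object `H`. -/
def atom (H : C) (hH : Monoform H) : ASpec C := Quotient.mk (atomSetoid C) ⟨H, hH⟩

theorem atom_eq_iff {H H' : C} (hH : Monoform H) (hH' : Monoform H') :
    atom H hH = atom H' hH' ↔ AtomEquiv H H' :=
  Quotient.eq (r := atomSetoid C)

theorem exists_rep (α : ASpec C) : ∃ (H : C) (hH : Monoform H), atom H hH = α := by
  obtain ⟨⟨H, hH⟩, h⟩ := Quotient.exists_rep α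
  exact ⟨H, hH, h⟩

/-- The atom support of `K`: the atoms of the monoform objects isomorphic to `L / L'` for some
`L' ⊆ L ⊆ K`. -/
def ASupp (K : C) : Set (ASpec C) :=
  {α | ∃ (H : C) (hH : Monoform H), atom H hH = α ∧
    ∃ (L L' : C) (j : L ⟶ K) (i : L' ⟶ L), Mono j ∧ Mono i ∧ Nonempty (H ≅ cokernel i)}

theorem ASupp_subset_of_mono {K K' : C} (k : K ⟶ K') [Mono k] : ASupp K ⊆ ASupp K' := by
  rintro α ⟨H, hH, e, L, L', j, i, hj, hi, h⟩
  exact ⟨H, hH, e, L, L', j ≫ k, i, inferInstance, hi, h⟩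

/-- The localization topology. -/
instance : TopologicalSpace (ASpec C) where
  IsOpen Φ := ∀ α ∈ Φ, ∃ (H : C) (hH : Monoform H), atom H hH = α ∧ ASupp H ⊆ Φ
  isOpen_univ α _ := by
    obtain ⟨H, hH, h⟩ := exists_rep α
    exact ⟨H, hH, h, Set.subset_univ _⟩
  isOpen_inter Φ Ψ hΦ hΨ α hα := by
    obtain ⟨H, hH, e, h⟩ := hΦ α hα.1
    obtain ⟨H', hH', e', h'⟩ := hΨ α hα.2
    obtain ⟨X, hX, f, g, _, _⟩ := (atom_eq_iff hH hH').1 (e.trans e'.symm)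
    refine ⟨X, hH.of_mono f hX, ?_, fun β hβ => ⟨h (ASupp_subset_of_mono f hβ),
      h' (ASupp_subset_of_mono g hβ)⟩⟩
    rw [← e, atom_eq_iff]
    exact ⟨X, hX, 𝟙 X, f, inferInstance, inferInstance⟩
  isOpen_sUnion S hS α := by
    rintro ⟨Φ, hΦ, hα⟩
    obtain ⟨H, hH, e, h⟩ := hS Φ hΦ α hα
    exact ⟨H, hH, e, h.trans (Set.subset_sUnion_of_mem hΦ)⟩

/-- The specialization order: `α ≤ β` if and only if `α` lies in the closure of `{β}`. -/
instance : Preorder (ASpec C) := specializationPreorder _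

theorem le_iff_mem_closure (α β : ASpec C) : α ≤ β ↔ α ∈ closure {β} :=
  specializes_iff_mem_closure

end

end AtomTheory

/-! ### The prime spectrum -/

/-- The prime spectrum of `A`, ordered by inclusion, with the topology whose open sets are the
specialization-closed subsets, that is, the subsets that are upward closed under inclusion.
(This is not the Zariski topology.) -/
abbrev SpSpec (A : Type u) [CommRing A] : Type u := Topology.WithUpperSet (PrimeSpectrum A)

/-! ### Lower triangular matrix rings -/

/-- The lower triangular matrices with entries `a : A`, `m : M`, `b : B`, where `a` and `b` are
the diagonal entries. -/
@[ext]
structure LowerTriangular (A : Type u) (B : Type v) (M : Type w) where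
  a : A
  m : M
  b : B

namespace LowerTriangular

section

variable {A : Type u} {B : Type v} {M : Type w} [Ring A] [Ring B] [AddCommGroup M]

instance : Zero (LowerTriangular A B M) := ⟨⟨0, 0, 0⟩⟩
instance : One (LowerTriangular A B M) := ⟨⟨1, 0, 1⟩⟩
instance : Add (LowerTriangular A B M) := ⟨fun s t => ⟨s.a + t.a, s.m + t.m, s.b + t.b⟩⟩
instance : Neg (LowerTriangular A B M) := ⟨fun s => ⟨-s.a, -s.m, -s.b⟩⟩

@[simp] theorem zero_a : (0 : LowerTriangular A B M).a = 0 := rfl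
@[simp] theorem zero_m : (0 : LowerTriangular A B M).m = 0 := rfl
@[simp] theorem zero_b : (0 : LowerTriangular A B M).b = 0 := rfl
@[simp] theorem one_a : (1 : LowerTriangular A B M).a = 1 := rfl
@[simp] theorem one_m : (1 : LowerTriangular A B M).m = 0 := rfl
@[simp] theorem one_b : (1 : LowerTriangular A B M).b = 1 := rfl
@[simp] theorem add_a (s t : LowerTriangular A B M) : (s + t).a = s.a + t.a := rfl
@[simp] theorem add_m (s t : LowerTriangular A B M) : (s + t).m = s.m + t.m := rfl
@[simp] theorem add_b (s t : LowerTriangular A B M) : (s + t).b = s.b + t.b := rfl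
@[simp] theorem neg_a (s : LowerTriangular A B M) : (-s).a = -s.a := rfl
@[simp] theorem neg_m (s : LowerTriangular A B M) : (-s).m = -s.m := rfl
@[simp] theorem neg_b (s : LowerTriangular A B M) : (-s).b = -s.b := rfl

variable [Module B M] [Module Aᵐᵒᵖ M]

/-- Matrix multiplication; the lower left entry of the product is `s.m * t.a + s.b * t.m`, where
the right action of `A` on `M` is an action of `Aᵐᵒᵖ`. -/
instance : Mul (LowerTriangular A B M) :=
  ⟨fun s t => ⟨s.a * t.a, MulOpposite.op t.a • s.m + s.b • t.m, s.b * t.b⟩⟩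

@[simp] theorem mul_a (s t : LowerTriangular A B M) : (s * t).a = s.a * t.a := rfl
@[simp] theorem mul_m (s t : LowerTriangular A B M) :
    (s * t).m = MulOpposite.op t.a • s.m + s.b • t.m := rfl
@[simp] theorem mul_b (s t : LowerTriangular A B M) : (s * t).b = s.b * t.b := rfl

variable [SMulCommClass B Aᵐᵒᵖ M]

instance : Ring (LowerTriangular A B M) where
  add_assoc _ _ _ := by ext <;> simp [add_assoc]
  zero_add _ := by ext <;> simp
  add_zero _ := by ext <;> simp
  add_comm _ _ := by ext <;> simp [add_comm]
  neg_add_cancel _ := by ext <;> simp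
  mul_assoc r s t := by
    ext <;> simp [mul_assoc, mul_smul, smul_add, add_assoc, smul_comm]
  one_mul _ := by ext <;> simp
  mul_one _ := by ext <;> simp
  zero_mul _ := by ext <;> simp
  mul_zero _ := by ext <;> simp
  left_distrib _ _ _ := by ext <;> simp [mul_add, add_smul]; abel
  right_distrib _ _ _ := by ext <;> simp [add_mul, add_smul]; abel
  nsmul := nsmulRec
  zsmul := zsmulRec

variable (A B M)

/-- The ring homomorphism `T → A` onto the upper left entry. -/
def toA : LowerTriangular A B M →+* A where
  toFun := a
  map_zero' := rfl
  map_one' := rfl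
  map_add' _ _ := rfl
  map_mul' _ _ := rfl

/-- The ring homomorphism `T → B` onto the lower right entry. -/
def toB : LowerTriangular A B M →+* B where
  toFun := b
  map_zero' := rfl
  map_one' := rfl
  map_add' _ _ := rfl
  map_mul' _ _ := rfl

variable {A}

/-- The left ideal `(I 0; M B)` of `T`. -/
def idealA (I : Ideal A) : Ideal (LowerTriangular A B M) where
  carrier := {t | t.a ∈ I}
  zero_mem' := I.zero_mem
  add_mem' := I.add_mem
  smul_mem' s _ ht := I.mul_mem_left s.a ht

variable {B} (A)

/-- The left ideal `(A 0; M J)` of `T`. -/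
def idealB (J : Ideal B) : Ideal (LowerTriangular A B M) where
  carrier := {t | t.b ∈ J}
  zero_mem' := J.zero_mem
  add_mem' := J.add_mem
  smul_mem' s _ ht := J.mul_mem_left s.b ht

end

end LowerTriangular

open AtomTheory

/-! Restriction of scalars along a surjective ring homomorphism is exact and fully faithful, and its
image, the modules killed by the kernel, is closed under subobjects. Such a functor preserves
monoform objects and matches atom supports (`ASupp_obj`), so it induces an open embedding of atom
spectra (`isOpenEmbedding_map`).

For `T → A` and `T → B` the two images are disjoint, because the idempotent `(1 0; 0 0)` is the
identity on `A`-modules and zero on `B`-modules. They cover everything because `ker toB * ker toA =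
0`: a monoform module not killed by `ker toA` contains a non-zero submodule killed by `ker toB`. The
order is the specialization order, so the homeomorphism is an order isomorphism.

Over a commutative ring, all non-zero elements of a monoform module have the same prime annihilator
`p`, so the module contains `A / p`. The atoms in the support of `A / p` are the primes above `p`,
hence open means upward closed. -/

namespace AtomTheory

/-! ### Monoform objects in an abelian category -/

section Abelian

variable {C : Type u} [Category.{v} C] [Abelian C]

theorem atom_eq_of_mono {H X : C} (hX : Monoform X) (hH : Monoform H) (i : X ⟶ H) [Mono i] :
    atom X hX = atom H hH :=
  (atom_eq_iff hX hH).2 ⟨X, hX.1, 𝟙 X, i, inferInstance, inferInstance⟩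

/-- An endomorphism of a monoform object is either zero or a monomorphism. -/
theorem Monoform.eq_zero_or_mono {H : C} (hH : Monoform H) (φ : H ⟶ H) : φ = 0 ∨ Mono φ := by
  by_cases h : IsZero (kernel φ)
  · right
    exact Preadditive.mono_of_kernel_zero (h.eq_of_src _ _)
  · left
    -- The coimage is `H / ker φ`; it also embeds in `H`, so it is a common subobject of the two.
    have h0 : IsZero (Abelian.coimage φ) :=
      hH.2 (kernel.ι φ) h (Abelian.factorThruCoimage φ) (𝟙 _)
    rw [← Abelian.coimage.fac φ, h0.eq_of_src (Abelian.factorThruCoimage φ) 0, comp_zero]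

end Abelian

/-! ### Fully faithful exact functors with image closed under subobjects -/

section Functor

universe v₁ v₂ u₁ u₂

variable {C : Type u₁} [Category.{v₁} C] [Abelian C] {D : Type u₂} [Category.{v₂} D] [Abelian D]
  (F : C ⥤ D) [F.Additive] [F.Full] [F.Faithful]

omit [F.Full] in
theorem isZero_obj_iff (X : C) : IsZero (F.obj X) ↔ IsZero X := by
  refine ⟨fun h => ?_, fun h => F.map_isZero h⟩
  rw [IsZero.iff_id_eq_zero]
  exact F.map_injective (h.eq_of_src _ _)

variable [PreservesFiniteLimits F] [PreservesFiniteColimits F]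

omit [F.Full] in
theorem Monoform.of_obj {H : C} (hH : Monoform (F.obj H)) : Monoform H := by
  refine ⟨fun h => hH.1 (F.map_isZero h), ?_⟩
  intro N i _ hN X f g _ _
  rw [← isZero_obj_iff F] at hN ⊢
  exact hH.2 (F.map i) hN (F.map f) (F.map g ≫ (PreservesCokernel.iso F i).hom)

/-- The essential image of `F` is closed under subobjects. -/
def ClosedUnderSubobjects (F : C ⥤ D) : Prop :=
  ∀ ⦃H : C⦄ ⦃X : D⦄ (i : X ⟶ F.obj H) [Mono i], ∃ X' : C, Nonempty (F.obj X' ≅ X)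

variable {F} (hF : ClosedUnderSubobjects F)
include hF

-- Closure is assumed for objects only; fullness lifts the inclusion as well, and faithfulness makes
-- the lift a monomorphism.
omit [Abelian D] [F.Additive] [PreservesFiniteColimits F] in
theorem ClosedUnderSubobjects.exists_mono {H : C} {X : D} (i : X ⟶ F.obj H) [Mono i] :
    ∃ (X' : C) (e : F.obj X' ≅ X) (i' : X' ⟶ H), Mono i' ∧ F.map i' = e.hom ≫ i := by
  obtain ⟨X', ⟨e⟩⟩ := hF i
  refine ⟨X', e, F.preimage (e.hom ≫ i), ?_, F.map_preimage _⟩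
  have : Mono (F.map (F.preimage (e.hom ≫ i))) := by
    rw [F.map_preimage]; infer_instance
  exact F.mono_of_mono_map this

theorem ClosedUnderSubobjects.monoform_obj {H : C} (hH : Monoform H) : Monoform (F.obj H) := by
  refine ⟨fun h => hH.1 ((isZero_obj_iff F H).1 h), ?_⟩
  intro N i _ hN X f g _ _
  obtain ⟨N', e, i', _, hi'⟩ := hF.exists_mono i
  obtain ⟨X', e', f', _, hf'⟩ := hF.exists_mono f
  have hN' : ¬ IsZero N' := fun h => hN ((F.map_isZero h).of_iso e.symm)
  -- By exactness the quotient in `D` comes from `C`, so the second embedding also descends by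
  -- fullness.
  let c : cokernel i ≅ F.obj (cokernel i') :=
    (cokernel.mapIso (F.map i') i e (Iso.refl _) (by simp [hi'])).symm ≪≫
      (PreservesCokernel.iso F i').symm
  have hg : Mono (F.map (F.preimage (e'.hom ≫ g ≫ c.hom))) := by
    rw [F.map_preimage]; infer_instance
  have := F.mono_of_mono_map hg
  exact (F.map_isZero (hH.2 i' hN' f' (F.preimage (e'.hom ≫ g ≫ c.hom)))).of_iso e'.symm

/-- The map on atoms induced by a fully faithful exact functor whose essential image is closed
under subobjects. -/
def ClosedUnderSubobjects.map : ASpec C → ASpec D :=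
  Quotient.lift (fun H : {H : C // Monoform H} => atom (F.obj H.1) (hF.monoform_obj H.2)) (by
    rintro ⟨H, hH⟩ ⟨H', hH'⟩ ⟨X, hX, f, g, _, _⟩
    exact (atom_eq_iff _ _).2 ⟨F.obj X, fun h => hX ((isZero_obj_iff F X).1 h), F.map f, F.map g,
      inferInstance, inferInstance⟩)

theorem ClosedUnderSubobjects.map_atom {H : C} (hH : Monoform H) :
    hF.map (atom H hH) = atom (F.obj H) (hF.monoform_obj hH) := rfl

theorem ClosedUnderSubobjects.map_injective : Function.Injective hF.map := by
  intro α β h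
  obtain ⟨H, hH, rfl⟩ := exists_rep α
  obtain ⟨H', hH', rfl⟩ := exists_rep β
  rw [hF.map_atom, hF.map_atom, atom_eq_iff] at h
  obtain ⟨X, hX, f, g, _, _⟩ := h
  obtain ⟨X', e, f', _, -⟩ := hF.exists_mono f
  have hg : Mono (F.map (F.preimage (e.hom ≫ g))) := by
    rw [F.map_preimage]; infer_instance
  exact (atom_eq_iff _ _).2 ⟨X', fun h => hX ((F.map_isZero h).of_iso e.symm), f', _, inferInstance,
    F.mono_of_mono_map hg⟩

/-- Both terms of a subquotient `L / L'` of `F.obj H` descend to `C`, and `F` preserves their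
cokernel. -/
theorem ClosedUnderSubobjects.ASupp_obj (H : C) : ASupp (F.obj H) = hF.map '' ASupp H := by
  ext α
  constructor
  · rintro ⟨K, hK, rfl, L, L', j, i, _, _, ⟨k⟩⟩
    obtain ⟨L₁, e, j', _, -⟩ := hF.exists_mono j
    obtain ⟨L₁', e', i', _, hi'⟩ := hF.exists_mono (i ≫ e.inv)
    let c : K ≅ F.obj (cokernel i') :=
      k ≪≫ (cokernel.mapIso (F.map i') i e' e (by simp [hi'])).symm ≪≫
        (PreservesCokernel.iso F i').symm
    have h : Monoform (F.obj (cokernel i')) :=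
      hK.of_mono c.inv fun h => hK.1 (h.of_iso c)
    refine ⟨atom _ (h.of_obj F), ⟨_, h.of_obj F, rfl, L₁, L₁', j', i', ‹_›, ‹_›, ⟨Iso.refl _⟩⟩, ?_⟩
    exact atom_eq_of_mono _ _ c.inv
  · rintro ⟨_, ⟨K, hK, rfl, L, L', j, i, _, _, ⟨k⟩⟩, rfl⟩
    exact ⟨F.obj K, hF.monoform_obj hK, rfl, F.obj L, F.obj L', F.map j, F.map i, inferInstance,
      inferInstance, ⟨F.mapIso k ≪≫ PreservesCokernel.iso F i⟩⟩

theorem ClosedUnderSubobjects.isOpenEmbedding_map : Topology.IsOpenEmbedding hF.map := by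
  refine .of_continuous_injective_isOpenMap ⟨fun Ψ hΨ α hα => ?_⟩ hF.map_injective
    fun Φ hΦ β hβ => ?_
  · obtain ⟨H, hH, rfl⟩ := exists_rep α
    obtain ⟨K, hK, e, hs⟩ := hΨ _ hα
    rw [hF.map_atom, atom_eq_iff] at e
    -- `K` need not lie in the image of `F`, but its common subobject with `F.obj H` does, and
    -- passing to it only shrinks the support.
    obtain ⟨X, hX, f, g, _, _⟩ := e
    obtain ⟨X', e, g', _, -⟩ := hF.exists_mono g
    have hX' : Monoform X' :=
      hH.of_mono g' fun h => hX ((F.map_isZero h).of_iso e.symm)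
    refine ⟨X', hX', atom_eq_of_mono _ _ g', ?_⟩
    rw [← Set.image_subset_iff, ← hF.ASupp_obj]
    exact (ASupp_subset_of_mono (e.hom ≫ f)).trans hs
  · obtain ⟨α, hα, rfl⟩ := hβ
    obtain ⟨H, hH, rfl, hs⟩ := hΦ α hα
    exact ⟨F.obj H, hF.monoform_obj hH, rfl, by rw [hF.ASupp_obj]; exact Set.image_mono hs⟩

end Functor

end AtomTheory

/-! ### Restriction of scalars along a surjection -/

namespace ModuleCat

section RestrictScalars

variable {R : Type u} {S : Type v} [Ring R] [Ring S] {φ : R →+* S}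

theorem exact_map_restrictScalars (φ : R →+* S) (K : ShortComplex (ModuleCat.{w} S))
    (h : K.Exact) : (K.map (restrictScalars.{w} φ)).Exact := by
  rw [ShortComplex.ShortExact.moduleCat_exact_iff_function_exact] at h ⊢
  exact h

instance preservesFiniteLimits_restrictScalars (φ : R →+* S) :
    PreservesFiniteLimits (restrictScalars.{w} φ) := by
  have h := ((restrictScalars.{w} φ).exact_tfae.out 1 3).1 (exact_map_restrictScalars φ)
  exact h.1

instance preservesFiniteColimits_restrictScalars (φ : R →+* S) :
    PreservesFiniteColimits (restrictScalars.{w} φ) := by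
  have h := ((restrictScalars.{w} φ).exact_tfae.out 1 3).1 (exact_map_restrictScalars φ)
  exact h.2

theorem full_restrictScalars_of_surjective (hφ : Function.Surjective φ) :
    (restrictScalars.{w} φ).Full where
  map_surjective {X Y} f := by
    refine ⟨ofHom
      { toFun := fun x => f.hom x
        map_add' := fun x y => f.hom.map_add x y
        map_smul' := fun s x => ?_ }, rfl⟩
    obtain ⟨r, rfl⟩ := hφ s
    exact f.hom.map_smul r x

/-- A module that is annihilated by the kernel of a surjective ring homomorphism is a restriction
of scalars. -/
theorem exists_restrictScalars_iso (hφ : Function.Surjective φ) (X : ModuleCat.{w} R)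
    (hX : ∀ r, φ r = 0 → ∀ x : X, r • x = 0) :
    ∃ X' : ModuleCat.{w} S, Nonempty ((restrictScalars φ).obj X' ≅ X) := by
  -- The choice of preimage is immaterial: two of them differ by an element of the kernel, which
  -- kills `X`.
  let _ : SMul S X := ⟨fun s x => Function.surjInv hφ s • x⟩
  have h : ∀ (r : R) (x : X), φ r • x = r • x := fun r x => by
    refine sub_eq_zero.1 ((sub_smul _ _ _).symm.trans (hX _ ?_ x))
    rw [map_sub, Function.surjInv_eq hφ, sub_self]
  let _ : Module S X := hφ.moduleLeft φ h
  let e : (restrictScalars φ).obj (of S X) ≃ₗ[R] X :=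
    { AddEquiv.refl X with map_smul' := h }
  exact ⟨of S X, ⟨e.toModuleIso⟩⟩

theorem closedUnderSubobjects_restrictScalars (hφ : Function.Surjective φ) :
    ClosedUnderSubobjects (restrictScalars.{w} φ) := by
  intro H X i _
  refine exists_restrictScalars_iso hφ X fun r hr x => (mono_iff_injective i).1 ‹_› ?_
  rw [map_smul, map_zero]
  change φ r • (i x : H) = 0
  rw [hr, zero_smul]

end RestrictScalars

end ModuleCat

/-! ### Specialization orders -/

theorem Sum.le_iff_specializes {X Y : Type*} [TopologicalSpace X] [TopologicalSpace Y] [Preorder X]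
    [Preorder Y] (hX : ∀ x x' : X, x ≤ x' ↔ x' ⤳ x) (hY : ∀ y y' : Y, y ≤ y' ↔ y' ⤳ y) :
    ∀ z z' : X ⊕ Y, z ≤ z' ↔ z' ⤳ z := by
  rintro (x | y) (x' | y')
  · rw [Sum.inl_le_inl_iff, hX, Topology.IsOpenEmbedding.inl.isInducing.specializes_iff]
  · simp only [Sum.not_inl_le_inr, false_iff]
    intro h
    -- The left summand is an open neighbourhood of `inl x`, so it would have to contain `inr y'`.
    simpa using h.mem_open isOpen_range_inl ⟨x, rfl⟩
  · simp only [Sum.not_inr_le_inl, false_iff]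
    intro h
    simpa using h.mem_open isOpen_range_inr ⟨y, rfl⟩
  · rw [Sum.inr_le_inr_iff, hY, Topology.IsOpenEmbedding.inr.isInducing.specializes_iff]

/-- A homeomorphism between preordered spaces that carry the specialization order is an order
isomorphism. -/
def Homeomorph.toOrderIso {X Y : Type*} [TopologicalSpace X] [TopologicalSpace Y] [Preorder X]
    [Preorder Y] (e : X ≃ₜ Y) (hX : ∀ x x' : X, x ≤ x' ↔ x' ⤳ x) (hY : ∀ y y' : Y, y ≤ y' ↔ y' ⤳ y) :
    X ≃o Y where
  toEquiv := e.toEquiv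
  map_rel_iff' {x x'} := by
    rw [hX, hY]
    exact e.isInducing.specializes_iff

/-! ### The atom spectrum of the triangular ring -/

namespace LowerTriangular

section

variable (A : Type u) (B : Type v) (M : Type w) [Ring A] [Ring B] [AddCommGroup M] [Module B M]
  [Module Aᵐᵒᵖ M] [SMulCommClass B Aᵐᵒᵖ M]

theorem toA_surjective : Function.Surjective (toA A B M) := fun a => ⟨⟨a, 0, 0⟩, rfl⟩

theorem toB_surjective : Function.Surjective (toB A B M) := fun b => ⟨⟨0, 0, b⟩, rfl⟩

instance : (ModuleCat.restrictScalars.{max u v w} (toA A B M)).Full :=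
  ModuleCat.full_restrictScalars_of_surjective (toA_surjective A B M)

instance : (ModuleCat.restrictScalars.{max u v w} (toB A B M)).Full :=
  ModuleCat.full_restrictScalars_of_surjective (toB_surjective A B M)

theorem closedUnderSubobjects_toA :
    ClosedUnderSubobjects (ModuleCat.restrictScalars.{max u v w} (toA A B M)) :=
  ModuleCat.closedUnderSubobjects_restrictScalars (toA_surjective A B M)

theorem closedUnderSubobjects_toB :
    ClosedUnderSubobjects (ModuleCat.restrictScalars.{max u v w} (toB A B M)) :=
  ModuleCat.closedUnderSubobjects_restrictScalars (toB_surjective A B M)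

variable {A B M}

-- This is `ker toB * ker toA = 0`. The order of the factors matters: the opposite product can have
-- a non-zero entry in `M`.
omit [SMulCommClass B Aᵐᵒᵖ M] in
theorem mul_eq_zero_of_b_of_a {s t : LowerTriangular A B M} (hs : s.b = 0) (ht : t.a = 0) :
    s * t = 0 := by
  ext <;> simp [hs, ht]

variable (A B M)

theorem not_atomEquiv (H : ModuleCat.{max u v w} A) (K : ModuleCat.{max u v w} B) :
    ¬ AtomEquiv ((ModuleCat.restrictScalars (toA A B M)).obj H)
      ((ModuleCat.restrictScalars (toB A B M)).obj K) := by
  rintro ⟨X, hX, f, g, hf, hg⟩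
  rw [ModuleCat.mono_iff_injective] at hf hg
  refine hX (ModuleCat.isZero_iff_subsingleton.2 ⟨fun x y => ?_⟩)
  have key : ∀ x : X, x = 0 := fun x => by
    -- This idempotent acts as zero on the `B`-module `K` and as the identity on the `A`-module `H`.
    have h : (⟨1, 0, 0⟩ : LowerTriangular A B M) • x = 0 := hg <| by
      rw [map_smul, map_zero]
      exact zero_smul B (g x : K)
    apply hf
    rw [map_zero]
    refine Eq.trans ?_ ((congrArg f h).trans (map_zero _))
    rw [map_smul]
    exact (one_smul A (f x : H)).symm
  rw [key x, key y]

theorem disjoint_range_map :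
    Disjoint (Set.range (closedUnderSubobjects_toA A B M).map)
      (Set.range (closedUnderSubobjects_toB A B M).map) := by
  rw [Set.disjoint_left]
  rintro _ ⟨α, rfl⟩ ⟨β, h⟩
  obtain ⟨H, hH, rfl⟩ := exists_rep α
  obtain ⟨K, hK, rfl⟩ := exists_rep β
  exact not_atomEquiv A B M H K ((atom_eq_iff _ _).1 h.symm)

/-- Every atom of `Mod T` comes from an `A`-module or a `B`-module. -/
theorem mem_range_map_or (α : ASpec (ModuleCat.{max u v w} (LowerTriangular A B M))) :
    α ∈ Set.range (closedUnderSubobjects_toA A B M).map ∨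
      α ∈ Set.range (closedUnderSubobjects_toB A B M).map := by
  obtain ⟨H, hH, rfl⟩ := exists_rep α
  by_cases h : ∀ t : LowerTriangular A B M, t.a = 0 → ∀ x : H, t • x = 0
  · left
    obtain ⟨K, ⟨e⟩⟩ := ModuleCat.exists_restrictScalars_iso (toA_surjective A B M) H h
    have hK := (hH.of_mono e.hom fun h => hH.1 (h.of_iso e.symm)).of_obj _
    exact ⟨atom K hK, atom_eq_of_mono _ _ e.hom⟩
  · right
    push Not at h
    obtain ⟨t, ht, x, hx⟩ := h
    -- Every element of `N` is `r • t • x` with `r * t` still in `ker toA`, so `ker toB` kills `N`.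
    let N := Submodule.span (LowerTriangular A B M) {t • x}
    have hN : ∀ s : LowerTriangular A B M, s.b = 0 → ∀ y : N, s • y = 0 := by
      rintro s hs ⟨y, hy⟩
      obtain ⟨r, rfl⟩ := Submodule.mem_span_singleton.1 hy
      refine Subtype.ext ?_
      change s • r • t • x = 0
      rw [smul_smul, smul_smul, mul_assoc,
        mul_eq_zero_of_b_of_a hs (show (r * t).a = 0 by simp [ht]), zero_smul]
    obtain ⟨K, ⟨e⟩⟩ := ModuleCat.exists_restrictScalars_iso (toB_surjective A B M)
      (ModuleCat.of _ N) hN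
    let i : ModuleCat.of _ N ⟶ H := ModuleCat.ofHom N.subtype
    have : Mono i := (ModuleCat.mono_iff_injective i).2 N.subtype_injective
    have h0 : ¬ IsZero (ModuleCat.of (LowerTriangular A B M) N) := fun h => by
      have := ModuleCat.isZero_iff_subsingleton.1 h
      have h1 := Subsingleton.elim (⟨t • x, Submodule.mem_span_singleton_self _⟩ : N) 0
      exact hx (congrArg Subtype.val h1)
    have hK := (hH.of_mono (e.hom ≫ i) fun h => h0 (h.of_iso e.symm)).of_obj _
    exact ⟨atom K hK, atom_eq_of_mono _ _ (e.hom ≫ i)⟩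

theorem isHomeomorph_sumElim_map :
    IsHomeomorph (Sum.elim (closedUnderSubobjects_toA A B M).map
      (closedUnderSubobjects_toB A B M).map) := by
  have hA := (closedUnderSubobjects_toA A B M).isOpenEmbedding_map
  have hB := (closedUnderSubobjects_toB A B M).isOpenEmbedding_map
  refine ⟨hA.continuous.sumElim hB.continuous, hA.isOpenMap.sumElim hB.isOpenMap, ?_, ?_⟩
  · refine hA.injective.sumElim hB.injective fun α β h => ?_
    exact (disjoint_range_map A B M).le_bot ⟨⟨α, rfl⟩, ⟨β, h.symm⟩⟩
  · intro α
    obtain ⟨β, h⟩ | ⟨β, h⟩ := mem_range_map_or A B M α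
    exacts [⟨Sum.inl β, h⟩, ⟨Sum.inr β, h⟩]

/-- The isomorphism of the disjoint union of the atom spectra of `A` and `B` with that of `T`. -/
noncomputable def aspecOrderIso :
    ASpec (ModuleCat.{max u v w} A) ⊕ ASpec (ModuleCat.{max u v w} B) ≃o
      ASpec (ModuleCat.{max u v w} (LowerTriangular A B M)) :=
  (isHomeomorph_sumElim_map A B M).homeomorph.toOrderIso
    (Sum.le_iff_specializes (fun _ _ => Iff.rfl) fun _ _ => Iff.rfl) fun _ _ => Iff.rfl

theorem isHomeomorph_aspecOrderIso : IsHomeomorph (aspecOrderIso A B M) :=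
  isHomeomorph_sumElim_map A B M

end

end LowerTriangular

/-! ### Atoms over a commutative ring -/

namespace AtomTheory

section CommRing

variable {A : Type u} [CommRing A]

theorem not_isZero_of_ne_zero {R : Type u} [Ring R] {H : ModuleCat.{v} R} {x : H}
    (hx : x ≠ 0) : ¬ IsZero H := fun h =>
  have := ModuleCat.isZero_iff_subsingleton.1 h
  hx (Subsingleton.elim _ _)

/-- A ring element acts on a monoform module over a commutative ring either by zero or
injectively. -/
theorem Monoform.smul_eq_zero_of_smul_eq_zero {H : ModuleCat.{v} A} (hH : Monoform H) {a : A}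
    {x : H} (hx : x ≠ 0) (h : a • x = 0) (y : H) : a • y = 0 := by
  obtain h0 | h0 := hH.eq_zero_or_mono (ModuleCat.ofHom (LinearMap.lsmul A H a))
  · exact congrArg (fun f : H ⟶ H => f y) h0
  · exact absurd ((ModuleCat.mono_iff_injective _).1 h0 (h.trans (smul_zero a).symm)) hx

theorem Monoform.exists_ne_zero {H : ModuleCat.{v} A} (hH : Monoform H) : ∃ x : H, x ≠ 0 := by
  by_contra! h
  exact hH.1 (ModuleCat.isZero_iff_subsingleton.2 ⟨fun x y => (h x).trans (h y).symm⟩)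

/-- The annihilator of a monoform module over a commutative ring is prime. -/
theorem Monoform.exists_prime {H : ModuleCat.{v} A} (hH : Monoform H) :
    ∃ p : PrimeSpectrum A, ∀ x : H, x ≠ 0 → ∀ a, a • x = 0 ↔ a ∈ p.asIdeal := by
  -- What kills one non-zero element kills all of `H`.
  have h : ∀ x : H, x ≠ 0 → ∀ a, a • x = 0 ↔ a ∈ Module.annihilator A H := fun x hx a =>
    ⟨fun h => Module.mem_annihilator.2 (hH.smul_eq_zero_of_smul_eq_zero hx h),
      fun h => Module.mem_annihilator.1 h x⟩
  obtain ⟨x, hx⟩ := hH.exists_ne_zero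
  refine ⟨⟨Module.annihilator A H, ⟨?_, ?_⟩⟩, h⟩
  · rw [Ideal.ne_top_iff_one, ← h x hx, one_smul]
    exact hx
  · intro a b hab
    rw [or_iff_not_imp_right]
    intro hb
    rw [← h x hx] at hb
    -- The non-zero element `b • x` is used to test whether `a` is in the annihilator.
    rwa [← h _ hb, smul_smul, h x hx]

/-- The module `A / p`, in a larger universe. -/
abbrev primeModule (p : PrimeSpectrum A) : ModuleCat.{max u v} A :=
  ModuleCat.of A (ULift.{v} (A ⧸ p.asIdeal))

theorem smul_primeModule_eq_zero_iff {p : PrimeSpectrum A} {x : primeModule.{u, v} p} (hx : x ≠ 0)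
    (a : A) : a • x = 0 ↔ a ∈ p.asIdeal := by
  obtain ⟨x⟩ := x
  obtain ⟨r, rfl⟩ := Ideal.Quotient.mk_surjective x
  have hr : r ∉ p.asIdeal := fun h => hx (congrArg ULift.up (Ideal.Quotient.eq_zero_iff_mem.2 h))
  have : a • (ULift.up (Ideal.Quotient.mk p.asIdeal r) : primeModule.{u, v} p) =
      ULift.up (Ideal.Quotient.mk p.asIdeal (a * r)) := rfl
  rw [this, ← p.2.mul_mem_iff_mem_or_mem.trans (or_iff_left hr), ← Ideal.Quotient.eq_zero_iff_mem]
  exact ⟨fun h => congrArg ULift.down h, fun h => congrArg ULift.up h⟩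

theorem primeModule_one_ne_zero (p : PrimeSpectrum A) :
    (ULift.up 1 : primeModule.{u, v} p) ≠ 0 := fun h =>
  p.2.ne_top (Ideal.Quotient.zero_eq_one_iff.1 (congrArg ULift.down h).symm)

/-- If `N` contains the class of `r ∉ p`, then `r` kills `(A / p) / N` but acts injectively on `A /
p`, so nothing non-zero embeds in both. -/
theorem monoform_primeModule (p : PrimeSpectrum A) : Monoform (primeModule.{u, v} p) := by
  refine ⟨not_isZero_of_ne_zero (primeModule_one_ne_zero p), ?_⟩
  intro N i hi hN X f g hf hg
  rw [ModuleCat.mono_iff_injective] at hi hf hg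
  by_contra hX
  rw [ModuleCat.isZero_iff_subsingleton, not_subsingleton_iff_nontrivial] at hN hX
  obtain ⟨n, hn⟩ := exists_ne (0 : N)
  obtain ⟨x, hx⟩ := exists_ne (0 : X)
  have hin : i n ≠ 0 := fun h => hn (hi (by rw [h, map_zero]))
  have hfx : f x ≠ 0 := fun h => hx (hf (by rw [h, map_zero]))
  obtain ⟨r, hr⟩ := Ideal.Quotient.mk_surjective (i n).down
  obtain ⟨y, hy⟩ := (ModuleCat.epi_iff_surjective (cokernel.π i)).1 inferInstance (g x)
  obtain ⟨s, hs⟩ := Ideal.Quotient.mk_surjective y.down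
  -- By commutativity, `r` times the class of `s` is `s` times the class of `r`, which lies in `N`.
  have hry : r • y = i (s • n) := by
    rw [map_smul]
    apply ULift.down_injective
    change r • y.down = s • (i n).down
    rw [← hr, ← hs]
    exact congrArg (Ideal.Quotient.mk p.asIdeal) (mul_comm r s)
  have hrx : r • x = 0 := hg <| by
    rw [map_smul, ← hy, ← map_smul, hry, map_zero]
    exact congrArg (fun k => k (s • n)) (cokernel.condition i)
  have hrp : r ∈ p.asIdeal := by
    rw [← smul_primeModule_eq_zero_iff hfx, ← map_smul, hrx, map_zero]
  apply hin
  apply ULift.down_injective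
  rw [← hr]
  exact Ideal.Quotient.eq_zero_iff_mem.2 hrp

/-- The atom of `A / p`. -/
def primeAtom (p : PrimeSpectrum A) : ASpec (ModuleCat.{max u v} A) :=
  atom (primeModule.{u, v} p) (monoform_primeModule p)

/-- A module with an element whose annihilator is `p` contains `A / p`. -/
theorem exists_mono_primeModule {p : PrimeSpectrum A} {H : ModuleCat.{max u v} A} {x : H}
    (hx : ∀ a, a • x = 0 ↔ a ∈ p.asIdeal) : ∃ i : primeModule.{u, v} p ⟶ H, Mono i := by
  let l : (A ⧸ p.asIdeal) →ₗ[A] H := Submodule.liftQ p.asIdeal (LinearMap.toSpanSingleton A H x)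
    fun a ha => (hx a).2 ha
  refine ⟨ModuleCat.ofHom (l ∘ₗ ULift.moduleEquiv.toLinearMap), ?_⟩
  rw [ModuleCat.mono_iff_injective]
  have hl : Function.Injective l := by
    rw [← LinearMap.ker_eq_bot]
    exact Submodule.ker_liftQ_eq_bot _ _ _ fun a ha => (hx a).1 ha
  exact hl.comp ULift.moduleEquiv.injective

/-- A non-zero element of a common subobject has annihilator `p`, since it also lives in `A / p`.
Thus `A / p` is the smallest representative of its atom. -/
theorem exists_mono_primeModule_of_atom_eq {p : PrimeSpectrum A} {H : ModuleCat.{max u v} A}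
    (hH : Monoform H) (h : atom H hH = primeAtom.{u, v} p) :
    ∃ i : primeModule.{u, v} p ⟶ H, Mono i := by
  obtain ⟨X, hX, f, g, hf, hg⟩ := (atom_eq_iff _ _).1 h
  rw [ModuleCat.mono_iff_injective] at hf hg
  rw [ModuleCat.isZero_iff_subsingleton, not_subsingleton_iff_nontrivial] at hX
  obtain ⟨x, hx⟩ := exists_ne (0 : X)
  have hgx : g x ≠ 0 := fun h => hx (hg (by rw [h, map_zero]))
  refine exists_mono_primeModule (x := f x) fun a => ?_
  rw [← smul_primeModule_eq_zero_iff hgx, ← map_smul, ← map_smul, map_eq_zero_iff _ hf,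
    map_eq_zero_iff _ hg]

theorem primeAtom_surjective : Function.Surjective (primeAtom.{u, v} (A := A)) := by
  intro α
  obtain ⟨H, hH, rfl⟩ := exists_rep α
  obtain ⟨p, hp⟩ := hH.exists_prime
  obtain ⟨x, hx⟩ := hH.exists_ne_zero
  obtain ⟨i, _⟩ := exists_mono_primeModule (hp x hx)
  exact ⟨p, atom_eq_of_mono _ _ i⟩

/-- The ideal `p` kills every subquotient of `A / p`, hence any `A / q` inside one, which forces `p
≤ q`. Conversely `A / q` is a quotient of `A / p`. -/
theorem primeAtom_mem_ASupp_iff {p q : PrimeSpectrum A} :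
    primeAtom.{u, v} q ∈ ASupp (primeModule.{u, v} p) ↔ p ≤ q := by
  constructor
  · rintro ⟨H, hH, h, L, L', j, i, hj, _, ⟨e⟩⟩ a ha
    obtain ⟨k, hk⟩ := exists_mono_primeModule_of_atom_eq hH h
    rw [ModuleCat.mono_iff_injective] at hk hj
    have hL : ∀ y : L, a • y = 0 := fun y => hj <| by
      rw [map_smul, map_zero]
      by_cases hy : j y = 0
      · rw [hy, smul_zero]
      · exact (smul_primeModule_eq_zero_iff hy a).2 ha
    rw [← smul_primeModule_eq_zero_iff (primeModule_one_ne_zero.{u, v} q)]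
    apply hk
    apply (ModuleCat.mono_iff_injective e.hom).1 inferInstance
    obtain ⟨y, hy⟩ := (ModuleCat.epi_iff_surjective (cokernel.π i)).1 inferInstance
      (e.hom (k (ULift.up 1)))
    rw [map_smul, map_smul, ← hy, ← map_smul, hL, map_zero, map_zero, map_zero]
  · intro h
    have h' : p.asIdeal ≤ q.asIdeal := h
    let l : primeModule.{u, v} p ⟶ primeModule.{u, v} q :=
      ModuleCat.ofHom (ULift.moduleEquiv.symm.toLinearMap ∘ₗ
        Submodule.factor h' ∘ₗ ULift.moduleEquiv.toLinearMap)
    have : Epi l := (ModuleCat.epi_iff_surjective l).2 <|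
      ULift.moduleEquiv.symm.surjective.comp
        ((Submodule.factor_surjective h').comp ULift.moduleEquiv.surjective)
    exact ⟨primeModule.{u, v} q, monoform_primeModule q, rfl, _, kernel l, 𝟙 _, kernel.ι l,
      inferInstance, inferInstance,
      ⟨(Abelian.epiIsCokernelOfKernel _ (kernelIsKernel l)).coconePointUniqueUpToIso
        (colimit.isColimit _)⟩⟩

/-- Openness can be tested on the representatives `A / p`: each embeds in every other representative
of its atom, so it has the least support. -/
theorem isOpen_iff_primeAtom {Φ : Set (ASpec (ModuleCat.{max u v} A))} :
    IsOpen Φ ↔ ∀ p q : PrimeSpectrum A, p ≤ q → primeAtom.{u, v} p ∈ Φ →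
      primeAtom.{u, v} q ∈ Φ := by
  constructor
  · intro hΦ p q hpq hp
    obtain ⟨H, hH, e, h⟩ := hΦ _ hp
    obtain ⟨i, _⟩ := exists_mono_primeModule_of_atom_eq hH e
    exact h (ASupp_subset_of_mono i (primeAtom_mem_ASupp_iff.2 hpq))
  · intro h α hα
    obtain ⟨p, rfl⟩ := primeAtom_surjective.{u, v} α
    refine ⟨_, monoform_primeModule p, rfl, fun β hβ => ?_⟩
    obtain ⟨q, rfl⟩ := primeAtom_surjective.{u, v} β
    exact h p q (primeAtom_mem_ASupp_iff.1 hβ) hα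

theorem primeAtom_injective : Function.Injective (primeAtom.{u, v} (A := A)) := by
  have h : ∀ p q : PrimeSpectrum A, primeAtom.{u, v} p = primeAtom.{u, v} q → p ≤ q := by
    intro p q h
    rw [← primeAtom_mem_ASupp_iff.{u, v}, ← h, primeAtom_mem_ASupp_iff]
  exact fun p q e => le_antisymm (h p q e) (h q p e.symm)

variable (A)

/-- The map sending a prime ideal to its atom is a homeomorphism. -/
theorem isHomeomorph_primeAtom :
    IsHomeomorph fun p : SpSpec A => primeAtom.{u, v} (Topology.WithUpperSet.ofUpperSet p) := by
  have key : ∀ Φ : Set (ASpec (ModuleCat.{max u v} A)), IsOpen Φ ↔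
      IsOpen ((fun p : SpSpec A => primeAtom.{u, v} (Topology.WithUpperSet.ofUpperSet p)) ⁻¹' Φ) :=
    fun Φ => by
      rw [isOpen_iff_primeAtom, Topology.IsUpperSet.isOpen_iff_isUpperSet]
      rfl
  refine ⟨⟨fun Φ => (key Φ).1⟩, fun Φ hΦ => (key _).2 ?_, primeAtom_injective, primeAtom_surjective⟩
  rwa [Set.preimage_image_eq]
  exact primeAtom_injective

end CommRing

end AtomTheory

/-! ### Prime quotients of the triangular ring -/

namespace LowerTriangular

section Primes

variable {A : Type u} {B : Type v} (M : Type w) [CommRing A] [CommRing B] [AddCommGroup M]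
  [Module B M] [Module Aᵐᵒᵖ M] [SMulCommClass B Aᵐᵒᵖ M]

-- The map sending a matrix to the class of its upper left entry is `T`-linear from `T` onto `A /
-- p`, with kernel `(p 0; M B)`. The lift to `max v w` puts `A / p` in the universe used for
-- `T`-modules.
variable (B) in
theorem nonempty_primeModule_iso_idealA (p : PrimeSpectrum A) :
    Nonempty ((ModuleCat.restrictScalars (toA A B M)).obj (primeModule.{u, max v w} p) ≅
      ModuleCat.of (LowerTriangular A B M) (LowerTriangular A B M ⧸ idealA B M p.asIdeal)) := by
  let H := (ModuleCat.restrictScalars (toA A B M)).obj (primeModule.{u, max v w} p)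
  let l : LowerTriangular A B M →ₗ[LowerTriangular A B M] H :=
    { toFun := fun t => ULift.up (Ideal.Quotient.mk p.asIdeal t.a)
      map_add' := fun _ _ => rfl
      map_smul' := fun _ _ => rfl }
  have hl : Function.Surjective l := by
    rintro ⟨x⟩
    obtain ⟨a, rfl⟩ := Ideal.Quotient.mk_surjective x
    exact ⟨⟨a, 0, 0⟩, rfl⟩
  have hk : LinearMap.ker l = idealA B M p.asIdeal := by
    ext t
    have hm : Ideal.Quotient.mk p.asIdeal t.a = 0 ↔ t.a ∈ p.asIdeal :=
      Ideal.Quotient.eq_zero_iff_mem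
    exact ⟨fun h => hm.1 (congrArg ULift.down h),
      fun h => congrArg ULift.up (hm.2 h)⟩
  exact ⟨((Submodule.quotEquivOfEq _ _ hk.symm).trans
    (l.quotKerEquivOfSurjective hl)).toModuleIso.symm⟩

variable (A) in
theorem nonempty_primeModule_iso_idealB (q : PrimeSpectrum B) :
    Nonempty ((ModuleCat.restrictScalars (toB A B M)).obj (primeModule.{v, max u w} q) ≅
      ModuleCat.of (LowerTriangular A B M) (LowerTriangular A B M ⧸ idealB A M q.asIdeal)) := by
  let H := (ModuleCat.restrictScalars (toB A B M)).obj (primeModule.{v, max u w} q)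
  let l : LowerTriangular A B M →ₗ[LowerTriangular A B M] H :=
    { toFun := fun t => ULift.up (Ideal.Quotient.mk q.asIdeal t.b)
      map_add' := fun _ _ => rfl
      map_smul' := fun _ _ => rfl }
  have hl : Function.Surjective l := by
    rintro ⟨x⟩
    obtain ⟨b, rfl⟩ := Ideal.Quotient.mk_surjective x
    exact ⟨⟨0, 0, b⟩, rfl⟩
  have hk : LinearMap.ker l = idealB A M q.asIdeal := by
    ext t
    have hm : Ideal.Quotient.mk q.asIdeal t.b = 0 ↔ t.b ∈ q.asIdeal :=
      Ideal.Quotient.eq_zero_iff_mem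
    exact ⟨fun h => hm.1 (congrArg ULift.down h),
      fun h => congrArg ULift.up (hm.2 h)⟩
  exact ⟨((Submodule.quotEquivOfEq _ _ hk.symm).trans
    (l.quotKerEquivOfSurjective hl)).toModuleIso.symm⟩

variable (B) in
theorem monoform_quotient_idealA (p : PrimeSpectrum A) :
    Monoform (ModuleCat.of (LowerTriangular A B M)
      (LowerTriangular A B M ⧸ idealA B M p.asIdeal)) := by
  obtain ⟨e⟩ := nonempty_primeModule_iso_idealA B M p
  have h := (closedUnderSubobjects_toA A B M).monoform_obj
    (monoform_primeModule.{u, max v w} p)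
  exact h.of_mono e.inv fun h0 => h.1 (h0.of_iso e)

variable (A) in
theorem monoform_quotient_idealB (q : PrimeSpectrum B) :
    Monoform (ModuleCat.of (LowerTriangular A B M)
      (LowerTriangular A B M ⧸ idealB A M q.asIdeal)) := by
  obtain ⟨e⟩ := nonempty_primeModule_iso_idealB A M q
  have h := (closedUnderSubobjects_toB A B M).monoform_obj
    (monoform_primeModule.{v, max u w} q)
  exact h.of_mono e.inv fun h0 => h.1 (h0.of_iso e)

variable (B) in
theorem map_primeAtom_toA (p : PrimeSpectrum A) :
    (closedUnderSubobjects_toA A B M).map (primeAtom.{u, max v w} p) =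
      atom _ (monoform_quotient_idealA B M p) := by
  obtain ⟨e⟩ := nonempty_primeModule_iso_idealA B M p
  exact atom_eq_of_mono _ _ e.hom

variable (A) in
theorem map_primeAtom_toB (q : PrimeSpectrum B) :
    (closedUnderSubobjects_toB A B M).map (primeAtom.{v, max u w} q) =
      atom _ (monoform_quotient_idealB A M q) := by
  obtain ⟨e⟩ := nonempty_primeModule_iso_idealB A M q
  exact atom_eq_of_mono _ _ e.hom

variable (A B)

/-- The homeomorphism from the disjoint union of the prime spectra of `A` and `B` to the atom
spectrum of `T`. -/
noncomputable def spSpecHomeomorph :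
    SpSpec A ⊕ SpSpec B ≃ₜ ASpec (ModuleCat.{max u v w} (LowerTriangular A B M)) :=
  ((isHomeomorph_primeAtom.{u, max v w} A).homeomorph.sumCongr
    (isHomeomorph_primeAtom.{v, max u w} B).homeomorph).trans
    (isHomeomorph_sumElim_map A B M).homeomorph

/-- The isomorphism of the disjoint union of the prime spectra of `A` and `B` with the atom
spectrum of `T`. -/
noncomputable def spSpecOrderIso :
    SpSpec A ⊕ SpSpec B ≃o ASpec (ModuleCat.{max u v w} (LowerTriangular A B M)) :=
  (spSpecHomeomorph A B M).toOrderIso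
    -- In the upper set topology specialization is inclusion of primes, so the homeomorphism again
    -- determines the order.
    (Sum.le_iff_specializes (fun _ _ => Topology.IsUpperSet.specializes_iff_le.symm)
      fun _ _ => Topology.IsUpperSet.specializes_iff_le.symm) fun _ _ => Iff.rfl

theorem isHomeomorph_spSpecOrderIso : IsHomeomorph (spSpecOrderIso A B M) :=
  (spSpecHomeomorph A B M).isHomeomorph

end Primes

end LowerTriangular

theorem mainTheorem8 :
    -- arbitrary rings
    (∀ (A : Type u) (B : Type v) (M : Type w) [Ring A] [Ring B] [AddCommGroup M]
        [Module B M] [Module Aᵐᵒᵖ M] [SMulCommClass B Aᵐᵒᵖ M],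
      ∃ (hA : ∀ H : ModuleCat.{max u v w} A, Monoform H →
            Monoform ((ModuleCat.restrictScalars (LowerTriangular.toA A B M)).obj H))
        (hB : ∀ H : ModuleCat.{max u v w} B, Monoform H →
            Monoform ((ModuleCat.restrictScalars (LowerTriangular.toB A B M)).obj H))
        (f : ASpec (ModuleCat.{max u v w} A) ⊕ ASpec (ModuleCat.{max u v w} B) ≃o
            ASpec (ModuleCat.{max u v w} (LowerTriangular A B M))),
        IsHomeomorph f ∧
        (∀ (H : ModuleCat.{max u v w} A) (hH : Monoform H),
          f (Sum.inl (atom H hH)) = atom _ (hA H hH)) ∧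
        (∀ (H : ModuleCat.{max u v w} B) (hH : Monoform H),
          f (Sum.inr (atom H hH)) = atom _ (hB H hH))) ∧
    -- commutative rings
    (∀ (A : Type u) (B : Type v) (M : Type w) [CommRing A] [CommRing B] [AddCommGroup M]
        [Module B M] [Module Aᵐᵒᵖ M] [SMulCommClass B Aᵐᵒᵖ M],
      ∃ (hp : ∀ p : PrimeSpectrum A, Monoform (ModuleCat.of (LowerTriangular A B M)
            (LowerTriangular A B M ⧸ LowerTriangular.idealA B M p.asIdeal)))
        (hq : ∀ q : PrimeSpectrum B, Monoform (ModuleCat.of (LowerTriangular A B M)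
            (LowerTriangular A B M ⧸ LowerTriangular.idealB A M q.asIdeal)))
        (f : SpSpec A ⊕ SpSpec B ≃o ASpec (ModuleCat.{max u v w} (LowerTriangular A B M))),
        IsHomeomorph f ∧
        (∀ p : PrimeSpectrum A,
          f (Sum.inl (Topology.WithUpperSet.toUpperSet p)) = atom _ (hp p)) ∧
        (∀ q : PrimeSpectrum B,
          f (Sum.inr (Topology.WithUpperSet.toUpperSet q)) = atom _ (hq q))) := by
  refine ⟨fun A B M _ _ _ _ _ _ => ?_, fun A B M _ _ _ _ _ _ => ?_⟩
  · exact ⟨fun H hH => (LowerTriangular.closedUnderSubobjects_toA A B M).monoform_obj hH,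
      fun H hH => (LowerTriangular.closedUnderSubobjects_toB A B M).monoform_obj hH,
      LowerTriangular.aspecOrderIso A B M, LowerTriangular.isHomeomorph_aspecOrderIso A B M,
      fun _ _ => rfl, fun _ _ => rfl⟩
  · exact ⟨LowerTriangular.monoform_quotient_idealA B M,
      LowerTriangular.monoform_quotient_idealB A M,
      LowerTriangular.spSpecOrderIso A B M, LowerTriangular.isHomeomorph_spSpecOrderIso A B M,
      LowerTriangular.map_primeAtom_toA B M, LowerTriangular.map_primeAtom_toB A M⟩
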